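/- Let $X$ and $Y$ be finite undirected simple graphs (not necessarily connected) with $N$ and $M$ vertices respectively; write $X$, $Y$ also for their vertex sets. Assume that $X$ has at least one edge or that $Y$ has no edges. Let $L_X^\dagger$, $L_Y^\dagger$ be the Moore-Penrose pseudoinverses of the graph Laplacians $L_X = D_X - A_X$, $L_Y = D_Y - A_Y$, and let $\mu^X$ on $\mathbb R^X$ and $\mu^Y$ on $\mathbb R^Y$ be the Gaussian measures with mean zero and covariance matrices $L_X^\dagger$ and $L_Y^\dagger$. Let $P : X\times Y\to[0,\infty)$ satisfy $\sum_{x\in X}P(x,y)=N$ for all $y\in Y$ and $\sum_{y\in Y}P(x,y)=M$ for all $x\in X$, and write $P$ also for the $X\times Y$ matrix with entries $P(x,y)$. Then \[ \inf_{\substack{T:\mathbb R^X\to\mathbb R^Y\\ T_\#\mu^X=\mu^Y}}\int_{\mathbb R^X}\sum_{x\in X}\sum_{y\in Y}\bigl(f(x)-Tf(y)\bigr)^2P(x,y)\,d\mu^X(f) = M\operatorname{tr}(L_X^\dagger)+N\operatorname{tr}(L_Y^\dagger)-2\operatorname{tr}\Bigl(\bigl((L_Y^\dagger)^{1/2}P^TL_X^\dagger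 P(L_Y^\dagger)^{1/2}\bigr)^{1/2}\Bigr), \] where the infimum is over all measurable (not necessarily linear) maps $T$ with $T_\#\mu^X=\mu^Y$, and $(\cdot)^{1/2}$ is the positive semidefinite square root. The set of such maps $T$ is nonempty, and the integral is finite for each of them. -/

import Mathlib

open Matrix MeasureTheory ProbabilityTheory
open scoped MatrixOrder

namespace COPT

/-- `B` is the Moore-Penrose pseudoinverse of the real matrix `A` (the four Penrose equations). -/
structure IsMoorePenroseInverse {V : Type*} [Fintype V] (A B : Matrix V V ℝ) : Prop where
  mul_mul_self : A * B * A = A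
  mul_self_mul : B * A * B = B
  symm_left : (A * B)ᵀ = A * B
  symm_right : (B * A)ᵀ = B * A

/-- The pseudoinverse of a symmetric real matrix `A`: every nonzero eigenvalue is inverted and the
kernel is kept (recall `0⁻¹ = 0` in `ℝ`). `isMoorePenroseInverse_pinv` and
`IsMoorePenroseInverse.eq` below show that this is the unique Moore-Penrose inverse of `A`. -/
noncomputable def pinv {V : Type*} [Fintype V] [DecidableEq V] (A : Matrix V V ℝ) :
    Matrix V V ℝ :=
  cfc (fun t : ℝ => t⁻¹) A

theorem isMoorePenroseInverse_pinv {V : Type*} [Fintype V] [DecidableEq V]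
    {A : Matrix V V ℝ} (hA : A.IsHermitian) : IsMoorePenroseInverse A (pinv A) := by
  have hA' : IsSelfAdjoint A := hA
  have hc : ∀ f : ℝ → ℝ, ContinuousOn f (spectrum ℝ A) := fun f =>
    (Matrix.finite_real_spectrum (A := A)).continuousOn f
  have h1 : A * pinv A = cfc (fun t : ℝ => t * t⁻¹) A := by
    rw [cfc_mul (fun t : ℝ => t) (fun t : ℝ => t⁻¹) A (hc _) (hc _), cfc_id' ℝ A]
    rfl
  have h2 : pinv A * A = cfc (fun t : ℝ => t * t⁻¹) A := by
    rw [show (fun t : ℝ => t * t⁻¹) = fun t => t⁻¹ * t from funext fun t => mul_comm _ _,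
      cfc_mul (fun t : ℝ => t⁻¹) (fun t : ℝ => t) A (hc _) (hc _), cfc_id' ℝ A]
    rfl
  have hs : (cfc (fun t : ℝ => t * t⁻¹) A)ᵀ = cfc (fun t : ℝ => t * t⁻¹) A := by
    have h : IsSelfAdjoint (cfc (fun t : ℝ => t * t⁻¹) A) := cfc_predicate _ _
    have h' := h.star_eq
    rwa [Matrix.star_eq_conjTranspose, Matrix.conjTranspose_eq_transpose_of_trivial] at h'
  refine ⟨?_, ?_, ?_, ?_⟩
  · rw [h1]
    calc cfc (fun t : ℝ => t * t⁻¹) A * A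
        = cfc (fun t : ℝ => t * t⁻¹) A * cfc (fun t : ℝ => t) A := by rw [cfc_id' ℝ A]
      _ = cfc (fun t : ℝ => t * t⁻¹ * t) A := (cfc_mul _ _ A (hc _) (hc _)).symm
      _ = A := by simp only [mul_inv_mul_cancel]; exact cfc_id' ℝ A
  · rw [h2]
    calc cfc (fun t : ℝ => t * t⁻¹) A * cfc (fun t : ℝ => t⁻¹) A
        = cfc (fun t : ℝ => t * t⁻¹ * t⁻¹) A := (cfc_mul _ _ A (hc _) (hc _)).symm
      _ = cfc (fun t : ℝ => t⁻¹) A := by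
        congr 1; funext t
        rcases eq_or_ne t 0 with h | h
        · simp [h]
        · rw [mul_inv_cancel₀ h, one_mul]
  · rw [h1]; exact hs
  · rw [h2]; exact hs

theorem IsMoorePenroseInverse.eq {V : Type*} [Fintype V] {A B C : Matrix V V ℝ}
    (hB : IsMoorePenroseInverse A B) (hC : IsMoorePenroseInverse A C) : B = C := by
  have e1 : A * B = A * C := by
    calc A * B = (A * B)ᵀ := hB.symm_left.symm
      _ = ((A * C) * (A * B))ᵀ := by rw [← Matrix.mul_assoc, hC.mul_mul_self]
      _ = (A * B) * (A * C) := by rw [Matrix.transpose_mul, hB.symm_left, hC.symm_left]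
      _ = A * C := by rw [← Matrix.mul_assoc, hB.mul_mul_self]
  have e2 : B * A = C * A := by
    calc B * A = (B * A)ᵀ := hB.symm_right.symm
      _ = ((B * A) * (C * A))ᵀ := by
        rw [Matrix.mul_assoc B, ← Matrix.mul_assoc A, hC.mul_mul_self]
      _ = (C * A) * (B * A) := by rw [Matrix.transpose_mul, hB.symm_right, hC.symm_right]
      _ = C * A := by rw [Matrix.mul_assoc C, ← Matrix.mul_assoc A, hB.mul_mul_self]
  calc B = B * A * B := hB.mul_self_mul.symm
    _ = C * A * B := by rw [e2]
    _ = C * A * C := by rw [Matrix.mul_assoc, e1, ← Matrix.mul_assoc]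
    _ = C := hC.mul_self_mul

theorem posSemidef_pinv {V : Type*} [Fintype V] [DecidableEq V] {A : Matrix V V ℝ}
    (hA : A.PosSemidef) : (pinv A).PosSemidef := by
  rw [← Matrix.nonneg_iff_posSemidef] at hA ⊢
  exact cfc_nonneg fun t ht => inv_nonneg.2 (spectrum_nonneg_of_nonneg hA ht)

/-- `L_G^†`, the Moore-Penrose pseudoinverse of the Laplacian matrix of the graph `G`. -/
noncomputable def lapPinv {V : Type*} [Fintype V] [DecidableEq V] (G : SimpleGraph V)
    [DecidableRel G.Adj] : Matrix V V ℝ :=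
  pinv (G.lapMatrix ℝ)

/-- It is positive semidefinite, so it is a covariance matrix and has a canonical square root. -/
theorem posSemidef_lapPinv {V : Type*} [Fintype V] [DecidableEq V] (G : SimpleGraph V)
    [DecidableRel G.Adj] : (lapPinv G).PosSemidef :=
  posSemidef_pinv (G.posSemidef_lapMatrix ℝ)

/-- The graph signal `μ^G`: the centred Gaussian on `ℝ^V` with covariance matrix `L_G^†`. -/
noncomputable def graphSignal {V : Type*} [Fintype V] [DecidableEq V] (G : SimpleGraph V)
    [DecidableRel G.Adj] : Measure (EuclideanSpace ℝ V) :=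
  multivariateGaussian 0 (lapPinv G)

/-- A transport plan between the vertex sets, normalised so that every column sums to `N = |VX|`
and every row to `M = |VY|`. -/
structure IsTransportPlan {VX VY : Type*} [Fintype VX] [Fintype VY] (P : Matrix VX VY ℝ) :
    Prop where
  nonneg : ∀ x y, 0 ≤ P x y
  col_sum : ∀ y, ∑ x, P x y = (Fintype.card VX : ℝ)
  row_sum : ∀ x, ∑ y, P x y = (Fintype.card VY : ℝ)

/-- A transport map: a measurable, not necessarily linear, map pushing `μ` forward to `ν`. -/
def IsTransportMap {E F : Type*} [MeasurableSpace E] [MeasurableSpace F]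
    (μ : Measure E) (ν : Measure F) (T : E → F) : Prop :=
  Measurable T ∧ μ.map T = ν

/-- The integrand `∑_{x,y} (f(x) - Tf(y))² P(x,y)`. -/
def integrand {VX VY : Type*} [Fintype VX] [Fintype VY] (P : Matrix VX VY ℝ)
    (T : EuclideanSpace ℝ VX → EuclideanSpace ℝ VY) (f : EuclideanSpace ℝ VX) : ℝ :=
  ∑ x, ∑ y, (f x - T f y) ^ 2 * P x y

end COPT

/-! Write A, B for the two covariances, H, R for their square roots, C = H P R and S = (CᵀC)^{1/2}.
When the square is expanded, the row and column sums of P turn the cost into M tr A + N tr B minus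
twice the correlation E⟨f, P Tf⟩ (`integral_integrand`). The claim is thus that the supremum of the
correlation over transport maps is tr S.

Upper bound (`correlation_le`): the Young inequality 2 a·Cb ≤ b·Sb + a·C S⁺Cᵀa, taken at a = H⁺f and
b = R⁺Tf, bounds the correlation by quadratic forms whose expectations depend on the marginals only;
each has mean tr S.

Lower bound: for independent standard Gaussians w, w', the pair f = Hw, g = R(S⁺Cᵀw + (1 - S⁺S)w')
is a coupling with correlation exactly tr S (`exists_optimal_coupling`). It need not be a graph over
f, but if A ≠ 0 the law of f has no atoms: after f is rounded to a countable net, each cell carries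
enough randomness to reproduce the conditional law of g, so a genuine map loses arbitrarily little
correlation (`exists_transport_correlation_ge`). If A = 0, then B = 0 and both laws are point
masses. -/

namespace COPT

/-! ### Atomless laws: approximating couplings by maps -/

section Transport

open Filter Topology Set unitInterval

/-- The probability integral transform: the distribution function of an atomless law on `ℝ`
transports it to the uniform law. -/
theorem exists_map_eq_volume_real (μ : Measure ℝ) [IsProbabilityMeasure μ]
    [NullSingletonClass μ] :
    ∃ U : ℝ → I, Measurable U ∧ μ.map U = volume := by
  have hcont : Continuous (cdf μ) := by
    refine continuous_iff_continuousAt.2 fun a => ?_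
    rw [(monotone_cdf μ).continuousAt_iff_leftLim_eq_rightLim, (cdf μ).rightLim_eq]
    have h : (cdf μ).measure {a} = 0 := by rw [measure_cdf]; exact measure_singleton a
    rw [StieltjesFunction.measure_singleton, ENNReal.ofReal_eq_zero] at h
    exact le_antisymm ((monotone_cdf μ).leftLim_le le_rfl) (by linarith)
  have hU : Measurable fun x => (⟨cdf μ x, cdf_nonneg μ x, cdf_le_one μ x⟩ : I) :=
    hcont.measurable.subtype_mk
  refine ⟨_, hU, ?_⟩
  have : IsProbabilityMeasure (μ.map fun x => (⟨cdf μ x, cdf_nonneg μ x, cdf_le_one μ x⟩ : I)) :=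
    Measure.isProbabilityMeasure_map hU.aemeasurable
  refine Measure.ext_of_Iic _ _ fun t => ?_
  rw [Measure.map_apply hU measurableSet_Iic, unitInterval.volume_Iic]
  -- By continuity this sublevel set is a closed half-line whose endpoint has distribution function
  -- t. The cases t = 1 and S empty are set apart, since S may then have no supremum.
  set S : Set ℝ := {x | cdf μ x ≤ t} with hS
  change μ S = _
  rcases eq_or_lt_of_le t.2.2 with ht | ht
  · have : S = univ := eq_univ_of_forall fun x => by
      rw [hS, mem_ofPred_eq, ht]; exact cdf_le_one μ x
    rw [this, ht]; simp
  obtain ⟨c, hc⟩ := ((tendsto_cdf_atTop μ).eventually (lt_mem_nhds ht)).exists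
  have hub : ∀ x ∈ S, x ≤ c := fun x hx => by
    by_contra! hlt
    exact absurd (monotone_cdf μ hlt.le) (not_le.2 (lt_of_le_of_lt hx hc))
  rcases S.eq_empty_or_nonempty with hemp | hne
  · have ht0 : (t : ℝ) ≤ 0 := by
      by_contra! h0
      obtain ⟨d, hd⟩ := ((tendsto_cdf_atBot μ).eventually (gt_mem_nhds h0)).exists
      exact (hemp ▸ (show d ∈ S from hd.le) : d ∈ (∅ : Set ℝ))
    rw [hemp, measure_empty, ENNReal.ofReal_of_nonpos ht0]
  · have hbdd : BddAbove S := ⟨c, hub⟩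
    have hbS : sSup S ∈ S := (isClosed_le hcont continuous_const).csSup_mem hne hbdd
    set b := sSup S with hb
    have hSb : S = Iic b := by
      ext x
      exact ⟨fun hx => le_csSup hbdd hx, fun hx => (monotone_cdf μ hx).trans hbS⟩
    obtain ⟨d, ⟨hbd, -⟩, hd⟩ := intermediate_value_Icc (hub b hbS) hcont.continuousOn ⟨hbS, hc.le⟩
    have hdb : d = b := le_antisymm (le_csSup hbdd (show d ∈ S from hd.le)) hbd
    rw [hSb, ← ofReal_cdf, ← hdb, hd]

/-- A measurable embedding into ℝ is injective, so it creates no atoms and reduces the claim to the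
line. -/
theorem exists_map_eq_volume {E : Type*} [MeasurableSpace E] [StandardBorelSpace E]
    (μ : Measure E) [IsProbabilityMeasure μ] [NullSingletonClass μ] :
    ∃ U : E → I, Measurable U ∧ μ.map U = volume := by
  have he := measurableEmbedding_embeddingReal E
  have : IsProbabilityMeasure (μ.map (embeddingReal E)) :=
    Measure.isProbabilityMeasure_map he.measurable.aemeasurable
  have : NullSingletonClass (μ.map (embeddingReal E)) := ⟨fun x => by
    rw [he.map_apply]
    exact (subsingleton_singleton.preimage he.injective).measure_zero μ⟩
  obtain ⟨U, hU, h⟩ := exists_map_eq_volume_real (μ.map (embeddingReal E))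
  exact ⟨U ∘ embeddingReal E, hU.comp he.measurable,
    by rw [← Measure.map_map hU he.measurable, h]⟩

/-- On an atomless standard Borel space, any countable discrete variable admits an independent
uniform variable. -/
theorem exists_uniform_indep {E : Type*} [MeasurableSpace E] [StandardBorelSpace E]
    (μ : Measure E) [IsProbabilityMeasure μ] [NullSingletonClass μ]
    {q : E → ℕ} (hq : Measurable q) :
    ∃ U : E → I, Measurable U ∧ μ.map (fun x => (q x, U x)) = (μ.map q).prod volume := by
  -- A fibre of positive mass carries an atomless conditional law, hence a uniform variable; on a
  -- null fibre any map will do. The law is uniform on every fibre, so the glued variable is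
  -- independent of `q`.
  have key : ∀ i : ℕ, ∃ U : E → I, Measurable U ∧
      (μ.restrict (q ⁻¹' {i})).map U = μ (q ⁻¹' {i}) • volume := by
    intro i
    rcases eq_or_ne (μ (q ⁻¹' {i})) 0 with h0 | h0
    · exact ⟨fun _ => 0, measurable_const, by
        rw [Measure.restrict_eq_zero.2 h0, h0, Measure.map_zero, zero_smul]⟩
    have hp : IsProbabilityMeasure (μ[|q ⁻¹' {i}]) := cond_isProbabilityMeasure h0
    have : NullSingletonClass (μ[|q ⁻¹' {i}]) := ⟨fun x =>
      cond_absolutelyContinuous (measure_singleton x)⟩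
    obtain ⟨U, hU, h⟩ := exists_map_eq_volume (μ[|q ⁻¹' {i}])
    refine ⟨U, hU, ?_⟩
    rw [← h, ProbabilityTheory.cond, Measure.map_smul, smul_smul,
      ENNReal.mul_inv_cancel h0 (measure_ne_top _ _), one_smul]
  choose V hV hVmap using key
  have hU : Measurable fun x => V (q x) x :=
    (measurable_from_prod_countable_right (f := fun p : ℕ × E => V p.1 p.2) hV).comp
      (hq.prodMk measurable_id)
  refine ⟨_, hU, ?_⟩
  symm
  refine Measure.prod_eq fun s t hs ht => ?_
  have hqs : MeasurableSet (q ⁻¹' s) := hq hs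
  rw [Measure.map_apply (hq.prodMk hU) (hs.prod ht), Measure.map_apply hq hs]
  have hdec : ∀ A : Set E, MeasurableSet A → μ A = ∑' i, μ (A ∩ q ⁻¹' {i}) := by
    intro A hA
    rw [← measure_iUnion (fun i j hij => ?_) fun i => hA.inter (hq (measurableSet_singleton i)),
      ← inter_iUnion, ← preimage_iUnion, iUnion_singleton_eq_range]
    · simp
    · refine disjoint_left.2 fun x hx hy => hij ?_
      exact hx.2.symm.trans hy.2
  rw [hdec _ ((hq.prodMk hU) (hs.prod ht)), hdec _ hqs, ← ENNReal.tsum_mul_right]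
  refine tsum_congr fun i => ?_
  by_cases hi : i ∈ s
  · have e1 : (fun x => (q x, V (q x) x)) ⁻¹' s ×ˢ t ∩ q ⁻¹' {i} = V i ⁻¹' t ∩ q ⁻¹' {i} := by
      ext x
      constructor
      · rintro ⟨⟨-, h⟩, h2 : q x = i⟩; subst h2; exact ⟨h, rfl⟩
      · rintro ⟨h, h2 : q x = i⟩; subst h2; exact ⟨⟨hi, h⟩, rfl⟩
    have e2 : q ⁻¹' s ∩ q ⁻¹' {i} = q ⁻¹' {i} :=
      inter_eq_right.2 (preimage_mono (singleton_subset_iff.2 hi))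
    have h := congrArg (fun m => m t) (hVmap i)
    simp only [Measure.map_apply (hV i) ht, Measure.restrict_apply (hV i ht),
      Measure.smul_apply, smul_eq_mul] at h
    rw [e1, e2, h]
  · have e1 : (fun x => (q x, V (q x) x)) ⁻¹' s ×ˢ t ∩ q ⁻¹' {i} = ∅ := by
      refine eq_empty_of_forall_notMem ?_
      rintro x ⟨⟨h, -⟩, h2 : q x = i⟩; subst h2; exact hi h
    have e2 : q ⁻¹' s ∩ q ⁻¹' {i} = ∅ := by
      refine eq_empty_of_forall_notMem ?_
      rintro x ⟨h, h2 : q x = i⟩; subst h2; exact hi h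
    rw [e1, e2, measure_empty, zero_mul]

/-- An atomless first marginal allows a prescribed joint law of a countable discretisation and the
image under a map. -/
theorem exists_map_prodMk_eq {E F : Type*} [MeasurableSpace E] [StandardBorelSpace E]
    [MeasurableSpace F] [StandardBorelSpace F] [Nonempty F]
    (μ : Measure E) [IsProbabilityMeasure μ] [NullSingletonClass μ]
    {q : E → ℕ} (hq : Measurable q) (ρ : Measure (ℕ × F)) [IsProbabilityMeasure ρ]
    (hρ : ρ.fst = μ.map q) :
    ∃ T : E → F, Measurable T ∧ μ.map (fun x => (q x, T x)) = ρ := by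
  obtain ⟨U, hU, hUmap⟩ := exists_uniform_indep μ hq
  -- Each conditional law of ρ is the image of the uniform law under some `g i`; feeding it the
  -- uniform variable independent of `q` rebuilds ρ.
  obtain ⟨g, hg, hgmap⟩ := Kernel.exists_measurable_map_eq_unitInterval ρ.condKernel
  have hT : Measurable fun x => g (q x) (U x) := hg.comp (hq.prodMk hU)
  refine ⟨_, hT, ?_⟩
  have hG : Measurable fun p : ℕ × I => (p.1, g p.1 p.2) := measurable_fst.prodMk hg
  have : IsProbabilityMeasure (μ.map q) := Measure.isProbabilityMeasure_map hq.aemeasurable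
  have h1 : μ.map (fun x => (q x, g (q x) (U x)))
      = ((μ.map q).prod volume).map (fun p : ℕ × I => (p.1, g p.1 p.2)) := by
    rw [← hUmap, Measure.map_map hG (hq.prodMk hU)]
    rfl
  rw [h1, ← ρ.disintegrate ρ.condKernel, hρ]
  ext s hs
  rw [Measure.map_apply hG hs, Measure.prod_apply (hG hs), Measure.compProd_apply hs]
  refine lintegral_congr fun i => ?_
  have hgi : Measurable (g i) := hg.comp measurable_prodMk_left
  rw [← hgmap, Measure.map_apply hgi (measurable_prodMk_left hs)]
  rfl

/-- Every coupling with an atomless first marginal agrees with one concentrated on a graph, up to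
moving the first coordinate by less than `ε`. -/
theorem exists_transport_near_coupling {Ω E F : Type*} [MeasurableSpace Ω]
    [PseudoMetricSpace E] [TopologicalSpace.SeparableSpace E] [Nonempty E]
    [MeasurableSpace E] [OpensMeasurableSpace E] [StandardBorelSpace E]
    [MeasurableSpace F] [StandardBorelSpace F] [Nonempty F]
    (m : Measure Ω) [IsProbabilityMeasure m] {f : Ω → E} {g : Ω → F}
    (hf : Measurable f) (hg : Measurable g) [NullSingletonClass (m.map f)]
    {ε : ℝ} (hε : 0 < ε) :
    ∃ (q : E → E) (T : E → F), Measurable q ∧ Measurable T ∧ (∀ x, dist x (q x) < ε) ∧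
      (m.map f).map (fun x => (q x, T x)) = m.map (fun ω => (q (f ω), g ω)) := by
  classical
  have hex : ∀ x : E, ∃ n, dist x (TopologicalSpace.denseSeq E n) < ε := fun x =>
    (TopologicalSpace.denseRange_denseSeq E).exists_dist_lt x hε
  -- The index of the first point of a dense sequence within ε: a countable discretisation of E.
  let k : E → ℕ := fun x => Nat.find (hex x)
  have hk : Measurable k := measurable_find hex fun n =>
    (isOpen_lt (by fun_prop) continuous_const).measurableSet
  have : IsProbabilityMeasure (m.map f) := Measure.isProbabilityMeasure_map hf.aemeasurable
  have hkg : Measurable fun ω => (k (f ω), g ω) := (hk.comp hf).prodMk hg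
  have : IsProbabilityMeasure (m.map fun ω => (k (f ω), g ω)) :=
    Measure.isProbabilityMeasure_map hkg.aemeasurable
  obtain ⟨T, hT, h⟩ := exists_map_prodMk_eq (m.map f) hk (m.map fun ω => (k (f ω), g ω)) (by
    rw [Measure.fst, Measure.map_map measurable_fst hkg, Measure.map_map hk hf]; rfl)
  have hd : Measurable (TopologicalSpace.denseSeq E) := measurable_from_nat
  refine ⟨fun x => TopologicalSpace.denseSeq E (k x), T, hd.comp hk, hT,
    fun x => Nat.find_spec (hex x), ?_⟩
  have hD : Measurable fun p : ℕ × F => (TopologicalSpace.denseSeq E p.1, p.2) :=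
    (hd.comp measurable_fst).prodMk measurable_snd
  have h2 := congrArg (Measure.map fun p : ℕ × F => (TopologicalSpace.denseSeq E p.1, p.2)) h
  rw [Measure.map_map hD (hk.prodMk hT), Measure.map_map hD hkg] at h2
  exact h2

end Transport

/-- A coupling with atomless first marginal can be replaced by a transport map between the same
marginals without decreasing a bilinear correlation by more than `δ`. -/
theorem exists_transport_correlation_ge {Ω E F : Type*} [MeasurableSpace Ω]
    [NormedAddCommGroup E] [InnerProductSpace ℝ E] [FiniteDimensional ℝ E]
    [MeasurableSpace E] [BorelSpace E]
    [NormedAddCommGroup F] [InnerProductSpace ℝ F] [FiniteDimensional ℝ F]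
    [MeasurableSpace F] [BorelSpace F]
    (m : Measure Ω) [IsProbabilityMeasure m] {f : Ω → E} {g : Ω → F}
    (hf : Measurable f) (hg : Measurable g) [NullSingletonClass (m.map f)] (L : F →L[ℝ] E)
    (hfg : Integrable (fun ω => inner ℝ (f ω) (L (g ω))) m)
    (hLg : Integrable (fun ω => ‖L (g ω)‖) m)
    (hT : ∀ T : E → F, Measurable T → (m.map f).map T = m.map g →
      Integrable (fun x => inner ℝ x (L (T x))) (m.map f))
    {δ : ℝ} (hδ : 0 < δ) :
    ∃ T : E → F, Measurable T ∧ (m.map f).map T = m.map g ∧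
      ∫ ω, inner ℝ (f ω) (L (g ω)) ∂m - δ ≤ ∫ x, inner ℝ x (L (T x)) ∂(m.map f) := by
  have : ProperSpace E := FiniteDimensional.proper ℝ E
  have : ProperSpace F := FiniteDimensional.proper ℝ F
  set K := ∫ ω, ‖L (g ω)‖ ∂m with hK
  have hK0 : 0 ≤ K := integral_nonneg fun _ => norm_nonneg _
  -- Rounding x to `q x` changes a correlation by at most εK and is done twice; K + 1 guards against
  -- K = 0.
  set ε := δ / (2 * (K + 1)) with hε
  have hεpos : 0 < ε := by positivity
  obtain ⟨q, T, hq, hTm, hqd, hlaw⟩ := exists_transport_near_coupling m hf hg hεpos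
  have hqf : Measurable fun ω => q (f ω) := hq.comp hf
  have hmap : (m.map f).map T = m.map g := by
    have h := congrArg (Measure.map (Prod.snd : E × F → F)) hlaw
    rw [Measure.map_map measurable_snd (hq.prodMk hTm),
      Measure.map_map measurable_snd (hqf.prodMk hg)] at h
    exact h
  have hpt : ∀ x y, |inner ℝ (q x) (L y) - inner ℝ x (L y)| ≤ ε * ‖L y‖ := by
    intro x y
    rw [← inner_sub_left]
    refine (abs_real_inner_le_norm _ _).trans (mul_le_mul_of_nonneg_right ?_ (norm_nonneg _))
    rw [← dist_eq_norm, dist_comm]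
    exact (hqd x).le
  have hLT : Integrable (fun x => ‖L (T x)‖) (m.map f) ∧ ∫ x, ‖L (T x)‖ ∂(m.map f) = K := by
    have hmeas : AEStronglyMeasurable (fun y => ‖L y‖) (m.map g) := by fun_prop
    have h1 : Integrable (fun y => ‖L y‖) (m.map g) :=
      (integrable_map_measure hmeas hg.aemeasurable).2 hLg
    rw [← hmap] at h1 hmeas
    refine ⟨(integrable_map_measure hmeas hTm.aemeasurable).1 h1, ?_⟩
    rw [hK, ← integral_map (f := fun y => ‖L y‖) hg.aemeasurable (by fun_prop), ← hmap,
      integral_map hTm.aemeasurable (by fun_prop)]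
  have hqT : Integrable (fun x => inner ℝ (q x) (L (T x))) (m.map f) := by
    have h : Integrable (fun x => inner ℝ (q x) (L (T x)) - inner ℝ x (L (T x))) (m.map f) :=
      (hLT.1.const_mul ε).mono' (by fun_prop) (ae_of_all _ fun x => hpt x _)
    exact (h.add (hT T hTm hmap)).congr (ae_of_all _ fun x => sub_add_cancel _ _)
  have hqg : Integrable (fun ω => inner ℝ (q (f ω)) (L (g ω))) m := by
    have h : Integrable (fun ω => inner ℝ (q (f ω)) (L (g ω)) - inner ℝ (f ω) (L (g ω))) m :=
      (hLg.const_mul ε).mono' (by fun_prop) (ae_of_all _ fun x => hpt _ _)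
    exact (h.add hfg).congr (ae_of_all _ fun x => sub_add_cancel _ _)
  -- The rounded correlations agree exactly, because they depend only on the common law given by
  -- `hlaw`.
  have heq : ∫ x, inner ℝ (q x) (L (T x)) ∂(m.map f) = ∫ ω, inner ℝ (q (f ω)) (L (g ω)) ∂m := by
    have h := congrArg (fun ρ => ∫ p : E × F, inner ℝ p.1 (L p.2) ∂ρ) hlaw
    rwa [integral_map (hq.prodMk hTm).aemeasurable (by fun_prop),
      integral_map (hqf.prodMk hg).aemeasurable (by fun_prop)] at h
  have h1 : ∫ x, inner ℝ (q x) (L (T x)) ∂(m.map f)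
      ≤ ∫ x, inner ℝ x (L (T x)) ∂(m.map f) + ε * K := by
    rw [← hLT.2, ← integral_const_mul, ← integral_add (hT T hTm hmap) (hLT.1.const_mul ε)]
    refine integral_mono hqT ((hT T hTm hmap).add (hLT.1.const_mul ε)) fun x => ?_
    have := (abs_le.1 (hpt x (T x))).2
    simp only
    linarith
  have h2 : ∫ ω, inner ℝ (f ω) (L (g ω)) ∂m
      ≤ ∫ ω, inner ℝ (q (f ω)) (L (g ω)) ∂m + ε * K := by
    rw [hK, ← integral_const_mul, ← integral_add hqg (hLg.const_mul ε)]
    refine integral_mono hfg (hqg.add (hLg.const_mul ε)) fun ω => ?_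
    have := (abs_le.1 (hpt (f ω) (g ω))).1
    simp only
    linarith
  have h3 : 2 * (ε * K) ≤ δ := by
    have : ε * (2 * (K + 1)) = δ := div_mul_cancel₀ _ (by positivity)
    nlinarith
  exact ⟨T, hTm, hmap, by linarith⟩

/-! ### Polar decomposition through the pseudoinverse of the modulus -/

section LinearAlgebra

theorem transpose_eq_of_nonneg {n : Type*} {S : Matrix n n ℝ} (hS : 0 ≤ S) : Sᵀ = S := by
  have h := (Matrix.nonneg_iff_posSemidef.1 hS).isHermitian
  rwa [Matrix.IsHermitian, Matrix.conjTranspose_eq_transpose_of_trivial] at h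

theorem dotProduct_mulVec_symm {m n : Type*} [Fintype m] [Fintype n]
    (Q : Matrix m n ℝ) (a : m → ℝ) (b : n → ℝ) :
    a ⬝ᵥ Q *ᵥ b = b ⬝ᵥ Qᵀ *ᵥ a := by
  rw [dotProduct_mulVec, ← mulVec_transpose, dotProduct_comm]

theorem mulVec_dotProduct_mulVec_self {m n : Type*} [Fintype m] [Fintype n]
    (D : Matrix m n ℝ) (t : n → ℝ) : D *ᵥ t ⬝ᵥ D *ᵥ t = t ⬝ᵥ (Dᵀ * D) *ᵥ t := by
  rw [dotProduct_mulVec_symm, mulVec_mulVec]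

variable {m n : Type*} [Fintype m] [Fintype n] [DecidableEq n]

theorem pinv_nonneg {S : Matrix n n ℝ} (hS : 0 ≤ S) : 0 ≤ pinv S :=
  Matrix.nonneg_iff_posSemidef.2 (posSemidef_pinv (Matrix.nonneg_iff_posSemidef.1 hS))

theorem isMoorePenroseInverse_pinv_of_nonneg {S : Matrix n n ℝ} (hS : 0 ≤ S) :
    IsMoorePenroseInverse S (pinv S) :=
  isMoorePenroseInverse_pinv (Matrix.nonneg_iff_posSemidef.1 hS).isHermitian

theorem pinv_mul_comm {S : Matrix n n ℝ} (hS : 0 ≤ S) : pinv S * S = S * pinv S := by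
  have h := (isMoorePenroseInverse_pinv_of_nonneg hS).symm_left
  rwa [transpose_mul, transpose_eq_of_nonneg hS, transpose_eq_of_nonneg (pinv_nonneg hS)] at h

/-- `C = C S⁺ S` for the modulus `S = (Cᵀ C)^{1/2}`. -/
theorem mul_pinv_mul_of_sq_eq {C : Matrix m n ℝ} {S : Matrix n n ℝ} (hS : 0 ≤ S)
    (h : S * S = Cᵀ * C) : C * (pinv S * S) = C := by
  -- A matrix with zero Gram matrix vanishes, and this Gram matrix sees C only through CᵀC = S S.
  have hz : C * (1 - pinv S * S) = 0 := by
    rw [← Matrix.conjTranspose_mul_self_eq_zero, Matrix.conjTranspose_eq_transpose_of_trivial,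
      transpose_mul, Matrix.mul_assoc, ← Matrix.mul_assoc Cᵀ, ← h, Matrix.mul_assoc S,
      Matrix.mul_sub S, Matrix.mul_one, ← Matrix.mul_assoc S,
      (isMoorePenroseInverse_pinv_of_nonneg hS).mul_mul_self]
    simp
  rw [Matrix.mul_sub, Matrix.mul_one, sub_eq_zero] at hz
  exact hz.symm

/-- By cyclicity the trace is that of CᵀC S⁺ = S S S⁺ = S. -/
theorem trace_mul_pinv_mul_transpose {C : Matrix m n ℝ} {S : Matrix n n ℝ} (hS : 0 ≤ S)
    (h : S * S = Cᵀ * C) : (C * pinv S * Cᵀ).trace = S.trace := by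
  rw [Matrix.trace_mul_comm, ← Matrix.mul_assoc, ← h, Matrix.mul_assoc, ← pinv_mul_comm hS,
    ← Matrix.mul_assoc, (isMoorePenroseInverse_pinv_of_nonneg hS).mul_mul_self]

/-- The Young inequality for the bilinear form of `C`, with weight the modulus of `C`. -/
theorem two_mul_dotProduct_le {C : Matrix m n ℝ} {S : Matrix n n ℝ} (hS : 0 ≤ S)
    (h : S * S = Cᵀ * C) (a : m → ℝ) (b : n → ℝ) :
    2 * (a ⬝ᵥ C *ᵥ b) ≤ b ⬝ᵥ S *ᵥ b + a ⬝ᵥ (C * pinv S * Cᵀ) *ᵥ a := by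
  have hGt := transpose_eq_of_nonneg (pinv_nonneg hS)
  have hSt := transpose_eq_of_nonneg hS
  have hC := mul_pinv_mul_of_sq_eq hS h
  -- The inequality is the nonnegativity of the form S at b - w; this w satisfies S w = Cᵀa, so it
  -- completes the square.
  set w := (pinv S * Cᵀ) *ᵥ a with hw
  have hpos : 0 ≤ (b - w) ⬝ᵥ S *ᵥ (b - w) := by
    simpa using (Matrix.nonneg_iff_posSemidef.1 hS).dotProduct_mulVec_nonneg (b - w)
  have hSw : S *ᵥ w = Cᵀ *ᵥ a := by
    rw [hw, mulVec_mulVec, ← Matrix.mul_assoc]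
    congr 1
    have := congrArg transpose hC
    rwa [transpose_mul, transpose_mul, hGt, hSt] at this
  have e1 : b ⬝ᵥ S *ᵥ w = a ⬝ᵥ C *ᵥ b := by
    rw [hSw, ← dotProduct_mulVec_symm]
  have e2 : w ⬝ᵥ S *ᵥ b = a ⬝ᵥ C *ᵥ b := by
    rw [dotProduct_mulVec_symm, hSt, e1]
  have e3 : w ⬝ᵥ S *ᵥ w = a ⬝ᵥ (C * pinv S * Cᵀ) *ᵥ a := by
    rw [hSw, ← dotProduct_mulVec_symm, hw,
      mulVec_mulVec, ← Matrix.mul_assoc]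
  rw [mulVec_sub, sub_dotProduct, dotProduct_sub, dotProduct_sub, e1, e2, e3] at hpos
  linarith

/-- The coefficients of a Gaussian vector correlated with another one through the partial isometry
`S⁺ Cᵀ` and completed by independent noise have unit covariance. -/
theorem dotProduct_polar_add {C : Matrix m n ℝ} {S : Matrix n n ℝ} (hS : 0 ≤ S)
    (h : S * S = Cᵀ * C) (t : n → ℝ) :
    (C * pinv S) *ᵥ t ⬝ᵥ (C * pinv S) *ᵥ t
      + (1 - pinv S * S) *ᵥ t ⬝ᵥ (1 - pinv S * S) *ᵥ t = t ⬝ᵥ t := by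
  have hGt := transpose_eq_of_nonneg (pinv_nonneg hS)
  have hG := isMoorePenroseInverse_pinv_of_nonneg hS
  have hQ : pinv S * S * (pinv S * S) = pinv S * S := by
    rw [← Matrix.mul_assoc, hG.mul_self_mul]
  -- C S⁺ is a partial isometry with initial projection S⁺S, and 1 - S⁺S is the complementary
  -- projection; the two Gram matrices add up to 1.
  have e1 : (C * pinv S)ᵀ * (C * pinv S) = pinv S * S := by
    rw [transpose_mul, hGt, Matrix.mul_assoc, ← Matrix.mul_assoc Cᵀ, ← h, Matrix.mul_assoc S,
      ← pinv_mul_comm hS, ← Matrix.mul_assoc, hQ]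
  have e2 : (1 - pinv S * S)ᵀ * (1 - pinv S * S) = 1 - pinv S * S := by
    rw [transpose_sub, transpose_one, hG.symm_right, Matrix.mul_sub, Matrix.mul_one,
      Matrix.sub_mul, Matrix.one_mul, hQ, sub_self, sub_zero]
  rw [mulVec_dotProduct_mulVec_self, mulVec_dotProduct_mulVec_self, e1, e2,
    ← dotProduct_add, ← add_mulVec]
  simp

end LinearAlgebra

/-! ### Second moments, atoms and support of centred Gaussians -/

section Gaussian

variable {m n : Type*} [Fintype m] [Fintype n] [DecidableEq n]

/-- The linear map of a rectangular matrix between Euclidean spaces. -/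
noncomputable def euclideanMap (Q : Matrix m n ℝ) : EuclideanSpace ℝ n →L[ℝ] EuclideanSpace ℝ m :=
  (toEuclideanLin Q).toContinuousLinearMap

@[simp]
theorem ofLp_euclideanMap (Q : Matrix m n ℝ) (x : EuclideanSpace ℝ n) :
    (euclideanMap Q x).ofLp = Q *ᵥ x.ofLp := rfl

theorem inner_eq_dotProduct {n : Type*} [Fintype n] (x y : EuclideanSpace ℝ n) :
    inner ℝ x y = x.ofLp ⬝ᵥ y.ofLp := by
  rw [EuclideanSpace.inner_eq_star_dotProduct, star_trivial, dotProduct_comm]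

theorem norm_sq_eq_dotProduct {n : Type*} [Fintype n] (x : EuclideanSpace ℝ n) :
    ‖x‖ ^ 2 = x.ofLp ⬝ᵥ x.ofLp := by
  rw [← real_inner_self_eq_norm_sq, inner_eq_dotProduct]

section Moments

variable {A : Matrix n n ℝ}

theorem memLp_eval_gaussian (A : Matrix n n ℝ) (i : n) :
    MemLp (fun x : EuclideanSpace ℝ n => x i) 2 (multivariateGaussian 0 A) :=
  (EuclideanSpace.proj (𝕜 := ℝ) i).comp_memLp'
    (IsGaussian.memLp_two_id (μ := multivariateGaussian 0 A))

theorem integral_eval_mul_eval (hA : A.PosSemidef) (i j : n) :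
    ∫ x, x i * x j ∂(multivariateGaussian 0 A) = A i j := by
  have h0 : ∀ i, ∫ x, x i ∂(multivariateGaussian 0 A) = 0 := fun i => by
    have h := (EuclideanSpace.proj (𝕜 := ℝ) i).integral_comp_comm
      (IsGaussian.integrable_id (μ := multivariateGaussian 0 A))
    simpa using h
  rw [← covariance_eval_multivariateGaussian (μ := 0) hA i j,
    covariance_eq_sub (memLp_eval_gaussian A i) (memLp_eval_gaussian A j), h0, h0]
  simp

theorem integrable_quadratic (A Q : Matrix n n ℝ) :
    Integrable (fun x : EuclideanSpace ℝ n => x.ofLp ⬝ᵥ Q *ᵥ x.ofLp)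
      (multivariateGaussian 0 A) := by
  simp only [dotProduct, mulVec, Finset.mul_sum]
  refine integrable_finsetSum _ fun i _ => integrable_finsetSum _ fun j _ => ?_
  refine (((memLp_eval_gaussian A i).integrable_mul (memLp_eval_gaussian A j)).const_mul
    (Q i j)).congr (ae_of_all _ fun x => ?_)
  simp only [Pi.mul_apply]
  ring

theorem integral_quadratic (hA : A.PosSemidef) (Q : Matrix n n ℝ) :
    ∫ x, x.ofLp ⬝ᵥ Q *ᵥ x.ofLp ∂(multivariateGaussian 0 A) = (Q * A).trace := by
  have hAt := transpose_eq_of_nonneg (Matrix.nonneg_iff_posSemidef.2 hA)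
  have hI : ∀ i j, Integrable (fun x : EuclideanSpace ℝ n => Q i j * (x i * x j))
      (multivariateGaussian 0 A) := fun i j =>
    ((memLp_eval_gaussian A i).integrable_mul (memLp_eval_gaussian A j)).const_mul _
  have e : ∀ x : EuclideanSpace ℝ n,
      x.ofLp ⬝ᵥ Q *ᵥ x.ofLp = ∑ i, ∑ j, Q i j * (x i * x j) := fun x => by
    simp only [dotProduct, mulVec, Finset.mul_sum]
    exact Finset.sum_congr rfl fun i _ => Finset.sum_congr rfl fun j _ => by ring
  simp_rw [e]
  rw [integral_finsetSum _ fun i _ => integrable_finsetSum _ fun j _ => hI i j]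
  simp_rw [integral_finsetSum _ fun j _ => hI _ j, integral_const_mul,
    integral_eval_mul_eval hA]
  simp only [trace, diag_apply, Matrix.mul_apply]
  refine Finset.sum_congr rfl fun i _ => Finset.sum_congr rfl fun j _ => ?_
  rw [← hAt, transpose_apply, hAt]

theorem multivariateGaussian_zero_eq_map (A : Matrix n n ℝ) :
    multivariateGaussian 0 A
      = (stdGaussian (EuclideanSpace ℝ n)).map (euclideanMap (CFC.sqrt A)) := by
  rw [multivariateGaussian]
  congr 1
  ext x i
  simp [ofLp_toEuclideanCLM]

/-- A nonzero positive semidefinite matrix has a positive diagonal entry; that coordinate is a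
nondegenerate real Gaussian, so no point has mass. -/
theorem nullSingletonClass_multivariateGaussian (hA : A.PosSemidef) (h0 : A ≠ 0) :
    NullSingletonClass (multivariateGaussian 0 A) := by
  obtain ⟨i, hi⟩ : ∃ i, A i i ≠ 0 := by
    by_contra! h
    exact h0 (hA.trace_eq_zero_iff.1 (Finset.sum_eq_zero fun i _ => h i))
  have hpos : 0 < A i i := lt_of_le_of_ne hA.diag_nonneg hi.symm
  have hmp := measurePreserving_eval_multivariateGaussian (μ := 0) hA (i := i)
  have : NullSingletonClass (gaussianReal ((0 : EuclideanSpace ℝ n) i) (A i i).toNNReal) :=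
    nullSingletonClass_gaussianReal (by simpa using hpos)
  refine ⟨fun x => measure_mono_null (t := (fun y : EuclideanSpace ℝ n => y i) ⁻¹' {x i}) ?_ ?_⟩
  · rintro _ rfl; rfl
  · rw [hmp.measure_preimage (measurableSet_singleton _).nullMeasurableSet]
    exact measure_singleton _

/-- A centred Gaussian vector lies in the range of its covariance almost surely. -/
theorem ae_mulVec_sqrt_pinv (A : Matrix n n ℝ) :
    ∀ᵐ x ∂(multivariateGaussian 0 A),
      (CFC.sqrt A * pinv (CFC.sqrt A)) *ᵥ x.ofLp = x.ofLp := by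
  rw [multivariateGaussian_zero_eq_map, ae_map_iff (by fun_prop)]
  · refine ae_of_all _ fun x => ?_
    rw [ofLp_euclideanMap, mulVec_mulVec,
      (isMoorePenroseInverse_pinv_of_nonneg (CFC.sqrt_nonneg A)).mul_mul_self]
  · exact (isClosed_eq (by fun_prop) (by fun_prop)).measurableSet

end Moments

/-! ### The maximal correlation of two Gaussians -/

section Correlation

variable [DecidableEq m] {A : Matrix m m ℝ} {B : Matrix n n ℝ}

theorem integrable_correlation (P : Matrix m n ℝ)
    {T : EuclideanSpace ℝ m → EuclideanSpace ℝ n}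
    (hT : IsTransportMap (multivariateGaussian 0 A) (multivariateGaussian 0 B) T) :
    Integrable (fun f => inner ℝ f (euclideanMap P (T f))) (multivariateGaussian 0 A) := by
  have hTm : ∀ j, MemLp (fun f => T f j) 2 (multivariateGaussian 0 A) := fun j =>
    (memLp_eval_gaussian B j).comp_measurePreserving ⟨hT.1, hT.2⟩
  simp only [inner_eq_dotProduct, ofLp_euclideanMap, dotProduct, mulVec, Finset.mul_sum]
  refine integrable_finsetSum _ fun i _ => integrable_finsetSum _ fun j _ => ?_
  refine (((memLp_eval_gaussian A i).integrable_mul (hTm j)).const_mul (P i j)).congr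
    (ae_of_all _ fun x => ?_)
  simp only [Pi.mul_apply]
  ring

/-- The maximal correlation of centred Gaussians with covariances `A` and `B` along `P`. -/
noncomputable def maxCorrelation (A : Matrix m m ℝ) (B : Matrix n n ℝ) (P : Matrix m n ℝ) : ℝ :=
  (CFC.sqrt (CFC.sqrt B * Pᵀ * A * P * CFC.sqrt B)).trace

/-- The matrix under the outer root is the Gram matrix of C = √A P √B, so `maxCorrelation` is the
trace of the modulus of C. -/
theorem sqrt_mul_sqrt_eq (hA : A.PosSemidef) (B : Matrix n n ℝ) (P : Matrix m n ℝ) :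
    CFC.sqrt (CFC.sqrt B * Pᵀ * A * P * CFC.sqrt B)
        * CFC.sqrt (CFC.sqrt B * Pᵀ * A * P * CFC.sqrt B)
      = (CFC.sqrt A * P * CFC.sqrt B)ᵀ * (CFC.sqrt A * P * CFC.sqrt B) := by
  have hH := transpose_eq_of_nonneg (CFC.sqrt_nonneg A)
  have hR := transpose_eq_of_nonneg (CFC.sqrt_nonneg B)
  have hAA := CFC.sqrt_mul_sqrt_self A (Matrix.nonneg_iff_posSemidef.2 hA)
  set H := CFC.sqrt A
  set R := CFC.sqrt B
  have e : R * Pᵀ * A * P * R = (H * P * R)ᵀ * (H * P * R) := by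
    rw [← hAA, transpose_mul, transpose_mul, hH, hR]
    simp only [Matrix.mul_assoc]
  have h0 : 0 ≤ (H * P * R)ᵀ * (H * P * R) := by
    rw [← Matrix.conjTranspose_eq_transpose_of_trivial]
    exact Matrix.nonneg_iff_posSemidef.2 (posSemidef_conjTranspose_mul_self _)
  rw [e]
  exact CFC.sqrt_mul_sqrt_self _ h0

/-- This is weak duality: U and V below define quadratic potentials dominating the correlation, and
their integrals depend on the marginals alone. -/
theorem correlation_le (hA : A.PosSemidef) (hB : B.PosSemidef) (P : Matrix m n ℝ)
    {T : EuclideanSpace ℝ m → EuclideanSpace ℝ n}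
    (hT : IsTransportMap (multivariateGaussian 0 A) (multivariateGaussian 0 B) T) :
    ∫ f, inner ℝ f (euclideanMap P (T f)) ∂(multivariateGaussian 0 A)
      ≤ maxCorrelation A B P := by
  have hSS := sqrt_mul_sqrt_eq hA B P
  rw [maxCorrelation]
  set S := CFC.sqrt (CFC.sqrt B * Pᵀ * A * P * CFC.sqrt B)
  have hAA := CFC.sqrt_mul_sqrt_self A (Matrix.nonneg_iff_posSemidef.2 hA)
  have hBB := CFC.sqrt_mul_sqrt_self B (Matrix.nonneg_iff_posSemidef.2 hB)
  have haeA := ae_mulVec_sqrt_pinv A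
  have haeB := ae_mulVec_sqrt_pinv B
  have hS : 0 ≤ S := CFC.sqrt_nonneg _
  have hH : 0 ≤ CFC.sqrt A := CFC.sqrt_nonneg _
  have hR : 0 ≤ CFC.sqrt B := CFC.sqrt_nonneg _
  set H := CFC.sqrt A
  set R := CFC.sqrt B
  set C := H * P * R with hC
  have hHt := transpose_eq_of_nonneg hH
  have hH't := transpose_eq_of_nonneg (pinv_nonneg hH)
  have hR't := transpose_eq_of_nonneg (pinv_nonneg hR)
  have hHmp := isMoorePenroseInverse_pinv_of_nonneg hH
  have hRmp := isMoorePenroseInverse_pinv_of_nonneg hR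
  have hSmp := isMoorePenroseInverse_pinv_of_nonneg hS
  set U := pinv H * (C * pinv S * Cᵀ) * pinv H with hU
  set V := pinv R * S * pinv R with hV
  -- A and B may be singular, so f and g are recovered from H⁺f and R⁺g only on the ranges of H and
  -- R, which carry the Gaussians almost surely.
  have hpt : ∀ f : m → ℝ, ∀ g : n → ℝ, (H * pinv H) *ᵥ f = f → (R * pinv R) *ᵥ g = g →
      f ⬝ᵥ P *ᵥ g ≤ (g ⬝ᵥ V *ᵥ g + f ⬝ᵥ U *ᵥ f) / 2 := by
    intro f g hf hg
    have h := two_mul_dotProduct_le hS hSS (pinv H *ᵥ f) (pinv R *ᵥ g)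
    have e1 : pinv H *ᵥ f ⬝ᵥ C *ᵥ pinv R *ᵥ g = f ⬝ᵥ P *ᵥ g := by
      have e : pinv H *ᵥ f ⬝ᵥ C *ᵥ pinv R *ᵥ g = (H * pinv H) *ᵥ f ⬝ᵥ P *ᵥ (R * pinv R) *ᵥ g := by
        rw [← mulVec_mulVec f H, dotProduct_comm (H *ᵥ _), dotProduct_mulVec_symm H, hHt]
        simp only [mulVec_mulVec, hC, Matrix.mul_assoc]
      rw [e, hf, hg]
    have e3 : pinv R *ᵥ g ⬝ᵥ S *ᵥ pinv R *ᵥ g = g ⬝ᵥ V *ᵥ g := by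
      rw [dotProduct_comm, dotProduct_mulVec_symm (pinv R), hR't]
      simp only [mulVec_mulVec, hV, Matrix.mul_assoc]
    have e4 : pinv H *ᵥ f ⬝ᵥ (C * pinv S * Cᵀ) *ᵥ pinv H *ᵥ f = f ⬝ᵥ U *ᵥ f := by
      rw [dotProduct_comm, dotProduct_mulVec_symm (pinv H), hH't]
      simp only [mulVec_mulVec, hU, Matrix.mul_assoc]
    rw [e1, e3, e4] at h
    linarith
  have hVB : (V * B).trace = S.trace := by
    -- S = S⁺CᵀC and C ends in the factor R, so S absorbs R⁺R.
    have hSR : S * (pinv R * R) = S := by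
      have hCR : C * (pinv R * R) = C := by
        rw [hC, Matrix.mul_assoc _ R, ← Matrix.mul_assoc R, hRmp.mul_mul_self]
      have e : S = pinv S * Cᵀ * C := by
        rw [Matrix.mul_assoc, ← hSS, ← Matrix.mul_assoc, pinv_mul_comm hS, hSmp.mul_mul_self]
      calc S * (pinv R * R) = pinv S * Cᵀ * C * (pinv R * R) := by rw [← e]
        _ = S := by rw [Matrix.mul_assoc, hCR, ← e]
    rw [hV, ← hBB, show pinv R * S * pinv R * (R * R) = pinv R * (S * (pinv R * R) * R) by
      simp only [Matrix.mul_assoc], hSR, Matrix.trace_mul_comm, Matrix.mul_assoc,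
      ← pinv_mul_comm hR, hSR]
  have hUA : (U * A).trace = S.trace := by
    have hHC : H * pinv H * C = C := by
      rw [hC, ← Matrix.mul_assoc, ← Matrix.mul_assoc, hHmp.mul_mul_self]
    rw [hU, ← hAA, show pinv H * (C * pinv S * Cᵀ) * pinv H * (H * H)
        = pinv H * (C * pinv S * Cᵀ * (pinv H * H) * H) by
      simp only [Matrix.mul_assoc], Matrix.trace_mul_comm,
      show C * pinv S * Cᵀ * (pinv H * H) * H * pinv H
        = C * pinv S * (Cᵀ * (pinv H * H) * (H * pinv H)) by simp only [Matrix.mul_assoc],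
      show Cᵀ * (pinv H * H) * (H * pinv H) = Cᵀ by
        have h := congrArg transpose hHC
        rw [transpose_mul, hHmp.symm_left] at h
        rw [pinv_mul_comm hH, h, h],
      trace_mul_pinv_mul_transpose hS hSS]
  have hTae : ∀ᵐ f ∂(multivariateGaussian 0 A), (R * pinv R) *ᵥ (T f).ofLp = (T f).ofLp := by
    rw [← hT.2] at haeB
    exact ae_of_ae_map hT.1.aemeasurable haeB
  have hI1 : Integrable (fun f => (T f).ofLp ⬝ᵥ V *ᵥ (T f).ofLp) (multivariateGaussian 0 A) :=
    (MeasurePreserving.mk hT.1 hT.2).integrable_comp_of_integrable (integrable_quadratic B V)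
  have hI2 := integrable_quadratic A U
  have e1 : ∫ f, (T f).ofLp ⬝ᵥ V *ᵥ (T f).ofLp ∂(multivariateGaussian 0 A) = S.trace := by
    rw [← hVB, ← integral_quadratic hB V, ← hT.2, integral_map hT.1.aemeasurable]
    rw [hT.2]; exact (integrable_quadratic B V).aestronglyMeasurable
  calc ∫ f, inner ℝ f (euclideanMap P (T f)) ∂(multivariateGaussian 0 A)
      ≤ ∫ f, ((T f).ofLp ⬝ᵥ V *ᵥ (T f).ofLp + f.ofLp ⬝ᵥ U *ᵥ f.ofLp) / 2
          ∂(multivariateGaussian 0 A) := by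
        refine integral_mono_ae (integrable_correlation P hT) ((hI1.add hI2).div_const 2) ?_
        filter_upwards [haeA, hTae] with f h1 h2
        rw [inner_eq_dotProduct]
        exact hpt _ _ h1 h2
    _ = S.trace := by
        rw [integral_div, integral_add hI1 hI2, e1, integral_quadratic hA, hUA]
        ring

/-- An optimal coupling of two centred Gaussians, driven by two independent standard Gaussian
vectors. -/
theorem exists_optimal_coupling (hA : A.PosSemidef) (hB : B.PosSemidef) (P : Matrix m n ℝ) :
    ∃ L : EuclideanSpace ℝ m × EuclideanSpace ℝ n →L[ℝ] EuclideanSpace ℝ n,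
      ((stdGaussian (EuclideanSpace ℝ m)).prod (stdGaussian (EuclideanSpace ℝ n))).map L
        = multivariateGaussian 0 B ∧
      Integrable (fun ω => inner ℝ (euclideanMap (CFC.sqrt A) ω.1) (euclideanMap P (L ω)))
        ((stdGaussian (EuclideanSpace ℝ m)).prod (stdGaussian (EuclideanSpace ℝ n))) ∧
      ∫ ω, inner ℝ (euclideanMap (CFC.sqrt A) ω.1) (euclideanMap P (L ω))
        ∂((stdGaussian (EuclideanSpace ℝ m)).prod (stdGaussian (EuclideanSpace ℝ n)))
        = maxCorrelation A B P := by
  have hSS := sqrt_mul_sqrt_eq hA B P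
  rw [maxCorrelation]
  set S := CFC.sqrt (CFC.sqrt B * Pᵀ * A * P * CFC.sqrt B)
  have hBB := CFC.sqrt_mul_sqrt_self B (Matrix.nonneg_iff_posSemidef.2 hB)
  have hS : 0 ≤ S := CFC.sqrt_nonneg _
  have hHt := transpose_eq_of_nonneg (CFC.sqrt_nonneg A)
  have hRt := transpose_eq_of_nonneg (CFC.sqrt_nonneg B)
  set H := CFC.sqrt A
  set R := CFC.sqrt B
  set C := H * P * R with hC
  have hGt := transpose_eq_of_nonneg (pinv_nonneg hS)
  have hCQ : C * (1 - pinv S * S) = 0 := by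
    rw [Matrix.mul_sub, mul_pinv_mul_of_sq_eq hS hSS, Matrix.mul_one, sub_self]
  -- The first summand is the polar part of Cᵀ. The second is independent noise that completes the
  -- covariance to B and, by `hCQ`, adds nothing to the correlation.
  let L : EuclideanSpace ℝ m × EuclideanSpace ℝ n →L[ℝ] EuclideanSpace ℝ n :=
    (euclideanMap (R * (C * pinv S)ᵀ)).comp (ContinuousLinearMap.fst ℝ _ _)
      + (euclideanMap (R * (1 - pinv S * S))).comp (ContinuousLinearMap.snd ℝ _ _)
  have hL : ∀ ω, (L ω).ofLp
      = (R * (C * pinv S)ᵀ) *ᵥ ω.1.ofLp + (R * (1 - pinv S * S)) *ᵥ ω.2.ofLp := fun _ => rfl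
  have hcorr : ∀ ω : EuclideanSpace ℝ m × EuclideanSpace ℝ n,
      inner ℝ (euclideanMap H ω.1) (euclideanMap P (L ω))
        = ω.1.ofLp ⬝ᵥ (C * pinv S * Cᵀ) *ᵥ ω.1.ofLp := by
    intro ω
    rw [inner_eq_dotProduct, ofLp_euclideanMap, ofLp_euclideanMap, hL, dotProduct_comm,
      dotProduct_mulVec_symm H, hHt, mulVec_add, mulVec_add]
    simp only [mulVec_mulVec]
    have e1 : H * (P * (R * (1 - pinv S * S))) = 0 := by
      rw [← hCQ, hC]; simp only [Matrix.mul_assoc]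
    have e2 : H * (P * (R * (C * pinv S)ᵀ)) = C * pinv S * Cᵀ := by
      rw [transpose_mul, hGt, hC]; simp only [Matrix.mul_assoc]
    rw [e1, e2, zero_mulVec, add_zero]
  have hstd : ∀ Q : Matrix m m ℝ, Integrable (fun x : EuclideanSpace ℝ m => x.ofLp ⬝ᵥ Q *ᵥ x.ofLp)
      (stdGaussian (EuclideanSpace ℝ m)) := fun Q => by
    rw [← multivariateGaussian_zero_one]; exact integrable_quadratic 1 Q
  have hLm : Measurable L := L.continuous.measurable
  clear_value L
  refine ⟨L, ?_, ?_, ?_⟩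
  · have : IsProbabilityMeasure
        (((stdGaussian (EuclideanSpace ℝ m)).prod (stdGaussian (EuclideanSpace ℝ n))).map L) :=
      Measure.isProbabilityMeasure_map hLm.aemeasurable
    refine Measure.ext_of_charFun (funext fun t => ?_)
    rw [charFun_multivariateGaussian hB, charFun_apply, integral_map hLm.aemeasurable (by fun_prop)]
    -- Independence factors the characteristic function, and `dotProduct_polar_add` at R t adds the
    -- two exponents up to that of covariance R R = B.
    have e : ∀ ω : EuclideanSpace ℝ m × EuclideanSpace ℝ n,
        inner ℝ (L ω) t = inner ℝ ω.1 (euclideanMap (C * pinv S) (euclideanMap R t))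
          + inner ℝ ω.2 (euclideanMap (1 - pinv S * S) (euclideanMap R t)) := by
      intro ω
      simp only [inner_eq_dotProduct, hL, ofLp_euclideanMap, add_dotProduct]
      rw [dotProduct_comm, dotProduct_mulVec_symm, dotProduct_comm (_ *ᵥ ω.2.ofLp),
        dotProduct_mulVec_symm _ t.ofLp]
      simp only [transpose_mul, transpose_transpose, hRt, hGt, transpose_sub, transpose_one,
        mulVec_mulVec, transpose_eq_of_nonneg hS, pinv_mul_comm hS]
    simp_rw [e, Complex.ofReal_add, add_mul, Complex.exp_add]
    rw [integral_prod_mul (fun x : EuclideanSpace ℝ m => Complex.exp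
        ((inner ℝ x (euclideanMap (C * pinv S) (euclideanMap R t)) : ℝ) * Complex.I))
        (fun x : EuclideanSpace ℝ n => Complex.exp
        ((inner ℝ x (euclideanMap (1 - pinv S * S) (euclideanMap R t)) : ℝ) * Complex.I)),
      ← charFun_apply, ← charFun_apply, charFun_stdGaussian, charFun_stdGaussian,
      ← Complex.exp_add]
    have h := dotProduct_polar_add hS hSS (R *ᵥ t.ofLp)
    rw [mulVec_dotProduct_mulVec_self R, hRt, hBB] at h
    rw [← h]
    congr 1
    simp only [← Complex.ofReal_pow, norm_sq_eq_dotProduct, ofLp_euclideanMap, inner_zero_right]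
    push_cast
    ring
  · simp_rw [hcorr]
    exact (hstd _).comp_fst _
  · simp_rw [hcorr]
    rw [integral_fun_fst (fun x : EuclideanSpace ℝ m => x.ofLp ⬝ᵥ (C * pinv S * Cᵀ) *ᵥ x.ofLp),
      probReal_univ, one_smul, ← multivariateGaussian_zero_one,
      integral_quadratic Matrix.PosSemidef.one, Matrix.mul_one, trace_mul_pinv_mul_transpose hS hSS]

theorem exists_transport_correlation_ge_maxCorrelation (hA : A.PosSemidef) (hA0 : A ≠ 0)
    (hB : B.PosSemidef) (P : Matrix m n ℝ) {δ : ℝ} (hδ : 0 < δ) :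
    ∃ T, IsTransportMap (multivariateGaussian 0 A) (multivariateGaussian 0 B) T ∧
      maxCorrelation A B P - δ
        ≤ ∫ f, inner ℝ f (euclideanMap P (T f)) ∂(multivariateGaussian 0 A) := by
  obtain ⟨L, hL, hint, hval⟩ := exists_optimal_coupling hA hB P
  have hfst : ((stdGaussian (EuclideanSpace ℝ m)).prod (stdGaussian (EuclideanSpace ℝ n))).map
      (fun ω => euclideanMap (CFC.sqrt A) ω.1) = multivariateGaussian 0 A := by
    rw [multivariateGaussian_zero_eq_map,
      ← Measure.fst_prod (μ := stdGaussian (EuclideanSpace ℝ m))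
        (ν := stdGaussian (EuclideanSpace ℝ n)), Measure.fst,
      Measure.map_map (by fun_prop) measurable_fst]
    rw [← Measure.fst, Measure.fst_prod]
    rfl
  have hnull := nullSingletonClass_multivariateGaussian hA hA0
  rw [← hfst] at hnull
  have hLint : Integrable (fun ω => ‖euclideanMap P (L ω)‖)
      ((stdGaussian (EuclideanSpace ℝ m)).prod (stdGaussian (EuclideanSpace ℝ n))) := by
    have h : Integrable (fun y => ‖euclideanMap P y‖) (multivariateGaussian 0 B) :=
      ((euclideanMap P).integrable_comp
        (IsGaussian.integrable_id (μ := multivariateGaussian 0 B))).norm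
    rw [← hL] at h
    exact h.comp_measurable (by fun_prop)
  obtain ⟨T, hTm, hT, hle⟩ := exists_transport_correlation_ge _
    (f := fun ω : EuclideanSpace ℝ m × EuclideanSpace ℝ n => euclideanMap (CFC.sqrt A) ω.1)
    (g := L) (by fun_prop) (by fun_prop) (euclideanMap P) hint hLint
    (fun T hTm hT => by
      rw [hfst, hL] at hT
      rw [hfst]
      exact integrable_correlation P ⟨hTm, hT⟩) hδ
  rw [hfst, hL] at hT
  rw [hval, hfst] at hle
  exact ⟨T, ⟨hTm, hT⟩, hle⟩

end Correlation

end Gaussian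

/-! ### From the cost to the correlation, and the graph case -/

section Cost

variable {m n : Type*} [Fintype m] [DecidableEq m] [Fintype n] [DecidableEq n]

theorem integrand_eq {P : Matrix m n ℝ} (hP : IsTransportPlan P)
    (T : EuclideanSpace ℝ m → EuclideanSpace ℝ n) (f : EuclideanSpace ℝ m) :
    integrand P T f = (Fintype.card n : ℝ) * (f.ofLp ⬝ᵥ (1 : Matrix m m ℝ) *ᵥ f.ofLp)
      + (Fintype.card m : ℝ) * ((T f).ofLp ⬝ᵥ (1 : Matrix n n ℝ) *ᵥ (T f).ofLp)
      - 2 * inner ℝ f (euclideanMap P (T f)) := by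
  have e1 : (Fintype.card n : ℝ) * (f.ofLp ⬝ᵥ f.ofLp) = ∑ x, ∑ y, f x * f x * P x y := by
    simp_rw [← Finset.mul_sum, hP.row_sum, dotProduct, ← Finset.sum_mul, mul_comm]
  have e2 : (Fintype.card m : ℝ) * ((T f).ofLp ⬝ᵥ (T f).ofLp)
      = ∑ x, ∑ y, T f y * T f y * P x y := by
    rw [Finset.sum_comm]
    simp_rw [← Finset.mul_sum, hP.col_sum, dotProduct, ← Finset.sum_mul, mul_comm]
  have e3 : f.ofLp ⬝ᵥ P *ᵥ (T f).ofLp = ∑ x, ∑ y, f x * (P x y * T f y) := by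
    simp only [dotProduct, mulVec, Finset.mul_sum]
  rw [one_mulVec, one_mulVec, inner_eq_dotProduct, ofLp_euclideanMap, e1, e2, e3, integrand]
  simp only [Finset.mul_sum, ← Finset.sum_add_distrib, ← Finset.sum_sub_distrib]
  refine Finset.sum_congr rfl fun x _ => Finset.sum_congr rfl fun y _ => ?_
  ring

theorem integrable_integrand {A : Matrix m m ℝ} {B : Matrix n n ℝ} {P : Matrix m n ℝ}
    (hP : IsTransportPlan P) {T : EuclideanSpace ℝ m → EuclideanSpace ℝ n}
    (hT : IsTransportMap (multivariateGaussian 0 A) (multivariateGaussian 0 B) T) :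
    Integrable (integrand P T) (multivariateGaussian 0 A) := by
  have h2 : Integrable (fun f => (T f).ofLp ⬝ᵥ (1 : Matrix n n ℝ) *ᵥ (T f).ofLp)
      (multivariateGaussian 0 A) :=
    (MeasurePreserving.mk hT.1 hT.2).integrable_comp_of_integrable (integrable_quadratic B 1)
  exact ((((integrable_quadratic A 1).const_mul _).add (h2.const_mul _)).sub
    ((integrable_correlation P hT).const_mul 2)).congr
    (ae_of_all _ fun f => (integrand_eq hP T f).symm)

theorem integral_integrand {A : Matrix m m ℝ} {B : Matrix n n ℝ} (hA : A.PosSemidef)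
    (hB : B.PosSemidef) {P : Matrix m n ℝ}
    (hP : IsTransportPlan P) {T : EuclideanSpace ℝ m → EuclideanSpace ℝ n}
    (hT : IsTransportMap (multivariateGaussian 0 A) (multivariateGaussian 0 B) T) :
    ∫ f, integrand P T f ∂(multivariateGaussian 0 A)
      = (Fintype.card n : ℝ) * A.trace + (Fintype.card m : ℝ) * B.trace
        - 2 * ∫ f, inner ℝ f (euclideanMap P (T f)) ∂(multivariateGaussian 0 A) := by
  have h1 := (integrable_quadratic A 1).const_mul (Fintype.card n : ℝ)
  have h2 : Integrable (fun f => (T f).ofLp ⬝ᵥ (1 : Matrix n n ℝ) *ᵥ (T f).ofLp)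
      (multivariateGaussian 0 A) :=
    (MeasurePreserving.mk hT.1 hT.2).integrable_comp_of_integrable (integrable_quadratic B 1)
  have h2' := h2.const_mul (Fintype.card m : ℝ)
  have e : ∫ f, (T f).ofLp ⬝ᵥ (1 : Matrix n n ℝ) *ᵥ (T f).ofLp ∂(multivariateGaussian 0 A)
      = B.trace := by
    rw [← Matrix.one_mul B, ← integral_quadratic hB 1, ← hT.2,
      integral_map hT.1.aemeasurable]
    rw [hT.2]; exact (integrable_quadratic B 1).aestronglyMeasurable
  simp_rw [integrand_eq hP]
  have h12 : Integrable (fun f => (Fintype.card n : ℝ) * (f.ofLp ⬝ᵥ (1 : Matrix m m ℝ) *ᵥ f.ofLp)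
      + (Fintype.card m : ℝ) * ((T f).ofLp ⬝ᵥ (1 : Matrix n n ℝ) *ᵥ (T f).ofLp))
      (multivariateGaussian 0 A) := h1.add h2'
  rw [integral_sub h12 ((integrable_correlation P hT).const_mul 2),
    integral_add h1 h2', integral_const_mul, integral_const_mul, integral_const_mul, e,
    integral_quadratic hA, Matrix.one_mul]

/-- The Monge problem between centred Gaussians, for a source that is not a point mass. -/
theorem isGLB_integral_integrand {A : Matrix m m ℝ} {B : Matrix n n ℝ} (hA : A.PosSemidef)
    (hB : B.PosSemidef) (hAB : A ≠ 0 ∨ B = 0) {P : Matrix m n ℝ} (hP : IsTransportPlan P) :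
    IsGLB {c : ℝ | ∃ T : EuclideanSpace ℝ m → EuclideanSpace ℝ n,
        IsTransportMap (multivariateGaussian 0 A) (multivariateGaussian 0 B) T ∧
        c = ∫ f, integrand P T f ∂(multivariateGaussian 0 A)}
      ((Fintype.card n : ℝ) * A.trace + (Fintype.card m : ℝ) * B.trace
        - 2 * maxCorrelation A B P) := by
  constructor
  · rintro _ ⟨T, hT, rfl⟩
    rw [integral_integrand hA hB hP hT]
    linarith [correlation_le hA hB P hT]
  · intro c hc
    have key : ∀ δ > 0, ∃ T, IsTransportMap (multivariateGaussian 0 A)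
        (multivariateGaussian 0 B) T ∧ maxCorrelation A B P - δ
          ≤ ∫ f, inner ℝ f (euclideanMap P (T f)) ∂(multivariateGaussian 0 A) := by
      intro δ hδ
      -- A point mass is sent to point masses only, which is why B must vanish with A; the constant
      -- map then has correlation 0 = tr S.
      by_cases hA0 : A = 0
      · have hB0 : B = 0 := hAB.resolve_left (not_not.2 hA0)
        refine ⟨fun _ => 0, ⟨measurable_const, ?_⟩, ?_⟩
        · rw [hB0, Measure.map_const, measure_univ, one_smul]
          simp [multivariateGaussian]
        · simp [maxCorrelation, hA0, hδ.le]
      · exact exists_transport_correlation_ge_maxCorrelation hA hA0 hB P hδ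
    refine le_of_forall_pos_le_add fun δ hδ => ?_
    -- Half of δ, because the correlation enters the cost with factor 2.
    obtain ⟨T, hT, hle⟩ := key (δ / 2) (half_pos hδ)
    have h := hc ⟨T, hT, rfl⟩
    rw [integral_integrand hA hB hP hT] at h
    linarith

end Cost

/-- The Penrose equations make a matrix and its pseudoinverse vanish together, and an edge is a
nonzero off-diagonal entry of the Laplacian. This turns the graph hypothesis into A ≠ 0 or B = 0. -/
theorem lapPinv_eq_zero_iff {V : Type*} [Fintype V] [DecidableEq V] (G : SimpleGraph V)
    [DecidableRel G.Adj] : lapPinv G = 0 ↔ G = ⊥ := by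
  have hmp := isMoorePenroseInverse_pinv (G.posSemidef_lapMatrix ℝ).isHermitian
  constructor
  · intro h
    have h0 : G.lapMatrix ℝ = 0 := by
      have h1 := hmp.mul_mul_self
      rw [show pinv (G.lapMatrix ℝ) = 0 from h] at h1
      simpa using h1.symm
    refine SimpleGraph.eq_bot_iff_forall_not_adj.2 fun a b hab => ?_
    have h1 := congrFun (congrFun h0 a) b
    simp [SimpleGraph.lapMatrix, SimpleGraph.degMatrix, hab, hab.ne] at h1
  · intro h
    have h0 : G.lapMatrix ℝ = 0 := by
      ext a b
      subst h
      simp [SimpleGraph.lapMatrix, SimpleGraph.degMatrix]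
    have h1 := hmp.mul_self_mul
    rw [h0] at h1
    rw [lapPinv, h0, ← h1]
    simp

end COPT

/-- Existence of a transport map is part of `IsGLB`: the empty subset of ℝ has no greatest lower
bound. Integrability ensures that no integral is the default value 0. -/
theorem lemma3p1 {VX VY : Type*} [Fintype VX] [DecidableEq VX] [Fintype VY] [DecidableEq VY]
    (X : SimpleGraph VX) [DecidableRel X.Adj] (Y : SimpleGraph VY) [DecidableRel Y.Adj]
    (hXY : X ≠ ⊥ ∨ Y = ⊥)
    (P : Matrix VX VY ℝ) (hP : COPT.IsTransportPlan P) :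
    (∀ T : EuclideanSpace ℝ VX → EuclideanSpace ℝ VY,
      COPT.IsTransportMap (COPT.graphSignal X) (COPT.graphSignal Y) T →
        Integrable (COPT.integrand P T) (COPT.graphSignal X)) ∧
    IsGLB {c : ℝ | ∃ T : EuclideanSpace ℝ VX → EuclideanSpace ℝ VY,
        COPT.IsTransportMap (COPT.graphSignal X) (COPT.graphSignal Y) T ∧
        c = ∫ f, COPT.integrand P T f ∂(COPT.graphSignal X)}
      ((Fintype.card VY : ℝ) * (COPT.lapPinv X).trace
        + (Fintype.card VX : ℝ) * (COPT.lapPinv Y).trace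
        - 2 * (CFC.sqrt (CFC.sqrt (COPT.lapPinv Y) * Pᵀ * COPT.lapPinv X * P
            * CFC.sqrt (COPT.lapPinv Y))).trace) := by
  have hAB : COPT.lapPinv X ≠ 0 ∨ COPT.lapPinv Y = 0 := by
    rwa [ne_eq, COPT.lapPinv_eq_zero_iff, COPT.lapPinv_eq_zero_iff]
  exact ⟨fun T hT => COPT.integrable_integrand hP hT,
    COPT.isGLB_integral_integrand (COPT.posSemidef_lapPinv X) (COPT.posSemidef_lapPinv Y) hAB hP⟩
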